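/- **Definitions.** Let $\mathfrak A$ be a (nonempty) structure in a countable vocabulary whose elements are reals (elements of ${}^\omega\omega$). Formulas are $\mathbb L_{\omega_1,\omega}(\mathbf Q)$-formulas ($\mathbf Q$ = "there are uncountably many") in this vocabulary with finitely many free variables. $(\mathfrak A,\Delta)$ is a ($\Sigma^1_1$-)*candidate* if the universe, the relations and the graphs of the functions of $\mathfrak A$ are $\Sigma^1_1$ (real parameters allowed), and $\Delta$ is a countable set of formulas $\varphi$ each of which defines a $\Sigma^1_1$ set $\{\bar a:\mathfrak A\models\varphi[\bar a]\}$; formulas $\varphi$ and $\neg\neg\varphi$ are identified. For $m<\omega$ let $\Phi^m$ be the set of pairs $(\varphi_0(\bar x,\bar b),\varphi_1(\bar x,\bar b))$ with $\varphi_0,\varphi_1\in\Delta$, $\bar x=\langle x_\ell:\ell<m\rangle$, $\bar b$ a finite sequence from $\mathfrak A$, and $\mathfrak A\models\neg\exists\bar x(\varphi_0(\bar x,\bar b)\wedge\varphi_1(\bar x,\bar b))$. For a set $N$ and $\bar a\in{}^m\mathfrak A$ let $(*)_{N,\bar a}$ say: there is a function $\mathbf c\in N$ from $\Phi^m$ to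 $\{0,1\}$ such that whenever $(\varphi_0(\bar x,\bar b),\varphi_1(\bar x,\bar b))\in\Phi^m\cap N$, $\ell<2$ and $\mathfrak A\models\varphi_\ell[\bar a,\bar b]$, then $\mathbf c$ takes the value $\ell$ at this pair. $(\mathfrak A,\Delta)$ is *$\aleph_0$-stable* if for every large enough regular $\chi$ and every well ordering $<^*_\chi$ of $\mathcal H(\chi)$ there is $x\in\mathcal H(\chi)$ such that $(*)_{N,\bar a}$ holds for every countable $N\prec(\mathcal H(\chi),\in,<^*_\chi)$ with $x\in N$, every $m<\omega$ and every $\bar a\in{}^m\mathfrak A$. Let $J$ be a linear order, $\bar a_t\in{}^m\mathfrak A$ for $t\in J$, and $A\subseteq\mathfrak A$. $\langle\bar a_t:t\in J\rangle$ is *$(\Delta,n_0,n_1)$-end-extension indiscernible over $A$* if for all increasing sequences $\langle r_\ell:\ell<n_0\rangle$, $\langle s_\ell:\ell<n_1\rangle$, $\langle t_\ell:\ell<n_1\rangle$ in $J$ such that every $r_i$ is below every $s_j$ and every $t_j$, the sequences $\bar a_{r_0}{}^\frown\cdots{}^\frown\bar a_{r_{n_0-1}}{}^\frown\bar a_{s_0}{}^\frown\cdots{}^\frown\bar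 a_{s_{n_1-1}}$ and $\bar a_{r_0}{}^\frown\cdots{}^\frown\bar a_{r_{n_0-1}}{}^\frown\bar a_{t_0}{}^\frown\cdots{}^\frown\bar a_{t_{n_1-1}}$ realize the same $\Delta$-type over $A$ in $\mathfrak A$; if $J$ has a last element, the same is also required for all $n_0'\le n_0$ and $n_1'\le n_1$. It is *$(\Delta,n)$-end-extension indiscernible* over $A$ if it is $(\Delta,n_0,n)$-end-extension indiscernible over $A$ for every $n_0<\omega$, and *$\Delta$-end-extension indiscernible* if it is $(\Delta,1)$-end-extension indiscernible. **Claim.** Let $(\mathfrak A,\Delta)$ be an $\aleph_0$-stable candidate. 1. In the definition of $\aleph_0$-stability the demand that $N$ is countable can be omitted: the definition still holds when $N$ ranges over all elementary submodels, and moreover for each regular $\chi$, each well ordering $<^*_\chi$ of $\mathcal H(\chi)$ and each $x\in\mathcal H(\chi)$, if $(*)_{N,\bar a}$ holds for all countable $N\prec(\mathcal H(\chi),\in,<^*_\chi)$ with $x\in N$ and all finite tuples $\bar a$ from $\mathfrak A$, then it holds for all $N\prec(\mathcal H(\chi),\in,<^*_\chi)$ with $x\in N$ and all such $\bar a$. Assume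 moreover that $\Delta$ is closed under negation and under permuting the variables, and let $m<\omega$, $\lambda$ a regular uncountable cardinal, $\bar a_\alpha\in{}^m\mathfrak A$ for $\alpha<\lambda$, $S\subseteq\lambda$ stationary, and $A\subseteq\mathfrak A$ with $|A|<\lambda$. 2. There is a stationary $S'\subseteq S$ such that $\langle\bar a_\alpha:\alpha\in S'\rangle$ is $\Delta$-end-extension indiscernible over $A$. 3. For every $n<\omega$ there is a stationary $S'\subseteq S$ such that $\langle\bar a_\alpha:\alpha\in S'\rangle$ is $(\Delta,n)$-end-extension indiscernible over $A$. 4. There are a club $E$ of $\lambda$ and functions $f_n$ ($n<\omega$), regressive on $S\cap E$, such that: (i) if $\alpha,\beta\in S\cap E$ and $f_{n+1}(\alpha)=f_{n+1}(\beta)$ then $f_n(\alpha)=f_n(\beta)$; (ii) for all $n<\omega$ and $\gamma<\lambda$, $\langle\bar a_\alpha:\alpha\in S\cap E,\ f_n(\alpha)=\gamma\rangle$ is $(\Delta,n)$-end-extension indiscernible over $A$; (ii)$^+$ for all $n<\omega$ and $\beta,\gamma<\lambda$, $\langle\bar a_\alpha:\alpha\in (S\cap E)\setminus\beta,\ f_n(\alpha)=\gamma\rangle$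 is $(\Delta,n)$-end-extension indiscernible over $A\cup\bigcup\{\operatorname{Rang}(\bar a_\delta):\delta<\beta\}$. -/

import Mathlib

open Cardinal

noncomputable section

namespace EndExt

/-! ### Formulas of the logic with countable conjunctions and the quantifier `Q`

Free variables are indexed by `ℕ`; bound variables are well-scoped de Bruijn levels, as in Mathlib's
`FirstOrder.Language.BoundedFormula`. -/

/-- Formulas of `𝕃_{ω₁,ω}(Q)` in the vocabulary `L`, with free variables in `ℕ` and with `n`
variables waiting to be bound.  Disjunctions and universal quantifiers are obtained by negation. -/
inductive InfFormula (L : FirstOrder.Language.{0, 0}) : ℕ → Type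
  | equal {n : ℕ} (t s : L.Term (ℕ ⊕ Fin n)) : InfFormula L n
  | rel {n k : ℕ} (R : L.Relations k) (ts : Fin k → L.Term (ℕ ⊕ Fin n)) : InfFormula L n
  | neg {n : ℕ} (φ : InfFormula L n) : InfFormula L n
  | conj {n : ℕ} (φ : ℕ → InfFormula L n) : InfFormula L n
  | ex {n : ℕ} (φ : InfFormula L (n + 1)) : InfFormula L n
  | exUncountable {n : ℕ} (φ : InfFormula L (n + 1)) : InfFormula L n

namespace InfFormula

variable {L : FirstOrder.Language.{0, 0}}

/-- Satisfaction; `exUncountable` says "there are uncountably many". -/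
def Realize {M : Type} [L.Structure M] :
    {n : ℕ} → InfFormula L n → (ℕ → M) → (Fin n → M) → Prop
  | _, equal t s, v, xs => t.realize (Sum.elim v xs) = s.realize (Sum.elim v xs)
  | _, rel R ts, v, xs => FirstOrder.Language.Structure.RelMap R fun i => (ts i).realize (Sum.elim v xs)
  | _, neg φ, v, xs => ¬ φ.Realize v xs
  | _, conj φ, v, xs => ∀ i, (φ i).Realize v xs
  | _, ex φ, v, xs => ∃ a : M, φ.Realize v (Fin.snoc xs a)
  | _, exUncountable φ, v, xs => ¬ {a : M | φ.Realize v (Fin.snoc xs a)}.Countable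

/-- The set of free variables. -/
def freeVars : {n : ℕ} → InfFormula L n → Set ℕ
  | _, equal t s => ↑t.varFinsetLeft ∪ ↑s.varFinsetLeft
  | _, rel _ ts => ⋃ i, ↑(ts i).varFinsetLeft
  | _, neg φ => φ.freeVars
  | _, conj φ => ⋃ i, (φ i).freeVars
  | _, ex φ => φ.freeVars
  | _, exUncountable φ => φ.freeVars

/-- Replace every free variable `v_i` by `v_{σ i}`. -/
def rename (σ : ℕ → ℕ) : {n : ℕ} → InfFormula L n → InfFormula L n
  | _, equal t s => equal (t.relabel (Sum.map σ id)) (s.relabel (Sum.map σ id))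
  | _, rel R ts => rel R fun i => (ts i).relabel (Sum.map σ id)
  | _, neg φ => neg (φ.rename σ)
  | _, conj φ => conj fun i => (φ i).rename σ
  | _, ex φ => ex (φ.rename σ)
  | _, exUncountable φ => exUncountable (φ.rename σ)

end InfFormula

/-- Formulas: nothing is waiting to be bound. -/
abbrev Fml (L : FirstOrder.Language.{0, 0}) : Type := InfFormula L 0

/-- `M ⊨ φ[l]`: the variable `v_i` is interpreted by the `i`-th entry of the finite sequence `l`.
This is used only if the free variables of `φ` are among `v_i`, `i < l.length`. -/
def Holds {L : FirstOrder.Language.{0, 0}} {M : Type} [L.Structure M] [Nonempty M]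
    (φ : Fml L) (l : List M) : Prop :=
  φ.Realize (fun i => l.getD i (Classical.arbitrary M)) Fin.elim0

/-- The free variables of `φ` are among `v_i`, `i < k`. -/
def FreeBelow {L : FirstOrder.Language.{0, 0}} (φ : Fml L) (k : ℕ) : Prop := φ.freeVars ⊆ Set.Iio k

/-- `Δ` is closed under negation, where `φ` and `¬¬φ` are identified. -/
def ClosedUnderNeg {L : FirstOrder.Language.{0, 0}} (Δ : Set (Fml L)) : Prop :=
  ∀ φ ∈ Δ, ∃ ψ ∈ Δ, ψ = φ.neg ∨ φ = ψ.neg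

/-- `Δ` is closed under permuting the (free) variables. -/
def ClosedUnderPerm {L : FirstOrder.Language.{0, 0}} (Δ : Set (Fml L)) : Prop :=
  ∀ σ : Equiv.Perm ℕ, ∀ φ ∈ Δ, φ.rename σ ∈ Δ

/-! ### Candidates

The reals are the elements of Baire space `ℕ → ℕ`. -/

/-- `A` is a `Σ¹₁`-model: its universe, its relations and (the graphs of) its functions are
`Σ¹₁`, that is, analytic. -/
structure IsSigmaModel (L : FirstOrder.Language.{0, 0}) (A : Set (ℕ → ℕ)) [L.Structure A] : Prop where
  carrier : MeasureTheory.AnalyticSet A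
  relations : ∀ (k : ℕ) (R : L.Relations k), MeasureTheory.AnalyticSet
    {v : Fin k → ℕ → ℕ | ∃ w : Fin k → A, (∀ i, v i = w i) ∧ FirstOrder.Language.Structure.RelMap R w}
  functions : ∀ (k : ℕ) (f : L.Functions k), MeasureTheory.AnalyticSet
    {p : (Fin k → ℕ → ℕ) × (ℕ → ℕ) | ∃ w : Fin k → A, (∀ i, p.1 i = w i) ∧
      p.2 = FirstOrder.Language.Structure.funMap f w}

/-- `(A, Δ)` is a `Σ¹₁`-candidate. -/
structure IsCandidate {L : FirstOrder.Language.{0, 0}} (A : Set (ℕ → ℕ)) [L.Structure A] [Nonempty A]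
    (Δ : Set (Fml L)) : Prop where
  model : IsSigmaModel L A
  countable : Δ.Countable
  finite_freeVars : ∀ φ ∈ Δ, φ.freeVars.Finite
  analytic : ∀ φ ∈ Δ, ∀ k, FreeBelow φ k → MeasureTheory.AnalyticSet
    {v : Fin k → ℕ → ℕ | ∃ w : Fin k → A, (∀ i, v i = w i) ∧ Holds φ (List.ofFn w)}

/-! ### The structures `(H(χ), ∈, <*)`

The set-theoretic universe is Mathlib's `ZFSet`. -/

/-- `H(χ)`: the sets whose transitive closure has cardinality less than `χ`, that is, which are
included in a transitive set of cardinality less than `χ`. -/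
def HSet (χ : Cardinal.{0}) : Set ZFSet.{0} :=
  {x | ∃ t : ZFSet.{0}, t.IsTransitive ∧ x ⊆ t ∧ t.card < χ}

/-- The two binary relation symbols, for membership and for a well ordering. -/
inductive SetRel : ℕ → Type
  | mem : SetRel 2
  | lt : SetRel 2

/-- The vocabulary `{∈, <*}`. -/
def setLang : FirstOrder.Language.{0, 0} := ⟨fun _ => Empty, SetRel⟩

/-- The universe of the structure `(H(χ), ∈, <*)`, where `<*` is `lt`. -/
@[nolint unusedArguments]
def HModel (χ : Cardinal.{0}) (_lt : HSet χ → HSet χ → Prop) : Type 1 := HSet χ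

instance (χ : Cardinal.{0}) (lt : HSet χ → HSet χ → Prop) : setLang.Structure (HModel χ lt) where
  funMap f := nomatch f
  RelMap R xs := match R with
    | SetRel.mem => (xs 0).1 ∈ (xs 1).1
    | SetRel.lt => lt (xs 0) (xs 1)

/-- The elements, as sets, of an elementary submodel of `(H(χ), ∈, <*)`. -/
def elems {χ : Cardinal.{0}} {lt : HSet χ → HSet χ → Prop}
    (N : setLang.ElementarySubstructure (HModel χ lt)) : Set ZFSet.{0} :=
  {z | ∃ y : HModel χ lt, y ∈ N ∧ y.1 = z}

/-! ### Reals, finite sequences and formulas as sets -/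

/-- Natural numbers as von Neumann ordinals. -/
def natSet (n : ℕ) : ZFSet.{0} := (n : Ordinal.{0}).toZFSet

/-- A finite sequence of sets, as a function with domain a natural number. -/
def finSeqSet {n : ℕ} (f : Fin n → ZFSet.{0}) : ZFSet.{0} :=
  ZFSet.range fun i : Fin n => ZFSet.pair (natSet i) (f i)

/-- An infinite sequence of sets, as a function with domain `ω`. -/
def seqSet (f : ℕ → ZFSet.{0}) : ZFSet.{0} :=
  ZFSet.range fun i : ℕ => ZFSet.pair (natSet i) (f i)

/-- An element of Baire space. -/
def realSet (x : ℕ → ℕ) : ZFSet.{0} := seqSet fun i => natSet (x i)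

/-- A finite sequence of elements of `A`. -/
def listSet {A : Set (ℕ → ℕ)} (l : List A) : ZFSet.{0} :=
  finSeqSet fun i : Fin l.length => realSet (l.get i).1

section codes

variable {L : FirstOrder.Language.{0, 0}} [Countable L.Symbols]

/-- The symbols of the countable vocabulary are identified with natural numbers. -/
def symbolSet (s : L.Symbols) : ZFSet.{0} :=
  natSet ((exists_injective_nat L.Symbols).choose s)

/-- Terms as sets. -/
def termSet {n : ℕ} : L.Term (ℕ ⊕ Fin n) → ZFSet.{0}
  | .var (.inl i) => ZFSet.pair (natSet 0) (natSet i)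
  | .var (.inr j) => ZFSet.pair (natSet 1) (natSet j)
  | .func f ts => ZFSet.pair (natSet 2)
      (ZFSet.pair (symbolSet (L := L) (.inl ⟨_, f⟩)) (finSeqSet fun i => termSet (ts i)))

/-- Formulas as sets. -/
def fmlSet : {n : ℕ} → InfFormula L n → ZFSet.{0}
  | _, .equal t s => ZFSet.pair (natSet 0) (ZFSet.pair (termSet t) (termSet s))
  | _, .rel R ts => ZFSet.pair (natSet 1)
      (ZFSet.pair (symbolSet (L := L) (.inr ⟨_, R⟩)) (finSeqSet fun i => termSet (ts i)))
  | _, .neg φ => ZFSet.pair (natSet 2) (fmlSet φ)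
  | _, .conj φ => ZFSet.pair (natSet 3) (seqSet fun i => fmlSet (φ i))
  | _, .ex φ => ZFSet.pair (natSet 4) (fmlSet φ)
  | _, .exUncountable φ => ZFSet.pair (natSet 5) (fmlSet φ)

end codes

/-! ### Stability -/

/-- The family `Φ^m` of all pairs `(φ₀(x̄, b̄), φ₁(x̄, b̄))` with `φ₀, φ₁ ∈ Δ`, `x̄ = ⟨x_ℓ : ℓ < m⟩`
and `b̄` a finite sequence from `A` such that `A ⊨ ¬ ∃ x̄ (φ₀(x̄, b̄) ∧ φ₁(x̄, b̄))`.
The variables `x̄` are the first `m` ones, and `b̄` interprets the next ones. -/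
structure PhiPair {L : FirstOrder.Language.{0, 0}} {A : Set (ℕ → ℕ)} [L.Structure A] [Nonempty A]
    (Δ : Set (Fml L)) (m : ℕ) : Type where
  φ : Fin 2 → Fml L
  b : List A
  mem : ∀ l, φ l ∈ Δ
  free : ∀ l, FreeBelow (φ l) (m + b.length)
  contradictory : ¬ ∃ x : Fin m → A, Holds (φ 0) (List.ofFn x ++ b) ∧ Holds (φ 1) (List.ofFn x ++ b)

section stability

variable {L : FirstOrder.Language.{0, 0}} {A : Set (ℕ → ℕ)} [L.Structure A] [Nonempty A] [Countable L.Symbols]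

/-- The pair `(φ₀(x̄, b̄), φ₁(x̄, b̄))` as a set. -/
def PhiPair.toSet {Δ : Set (Fml L)} {m : ℕ} (p : PhiPair (A := A) Δ m) : ZFSet.{0} :=
  ZFSet.pair (ZFSet.pair (fmlSet (p.φ 0)) (listSet p.b))
    (ZFSet.pair (fmlSet (p.φ 1)) (listSet p.b))

instance (Δ : Set (Fml L)) (m : ℕ) : Small.{0} (PhiPair (A := A) Δ m) := small_self _

/-- The set `Φ^m`. -/
def PhiSet (A : Set (ℕ → ℕ)) [L.Structure A] [Nonempty A] (Δ : Set (Fml L)) (m : ℕ) : ZFSet.{0} :=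
  ZFSet.range fun p : PhiPair (A := A) Δ m => p.toSet

/-- The weak definability of `tp_Δ(ā, N ∩ A, A)`: some function `c ∈ N` from `Φ^m` to `{0, 1}`
satisfies: if `(φ₀(x̄, b̄), φ₁(x̄, b̄)) ∈ Φ^m ∩ N` and `A ⊨ φ_ℓ[ā, b̄]` then `c` maps this pair to
`ℓ`. -/
def WeaklyDefinable (Δ : Set (Fml L)) (N : Set ZFSet.{0}) {m : ℕ} (a : Fin m → A) : Prop :=
  ∃ c ∈ N, ZFSet.IsFunc (PhiSet A Δ m) (natSet 2) c ∧
    ∀ p : PhiPair (A := A) Δ m, p.toSet ∈ N →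
      ∀ l : Fin 2, Holds (p.φ l) (List.ofFn a ++ p.b) → ZFSet.pair p.toSet (natSet l) ∈ c

/-- All `Δ`-types of finite tuples over the countable elementary submodels of `(H(χ), ∈, <*)` to
which `x` belongs are weakly definable. -/
def DefinableOverCountable (A : Set (ℕ → ℕ)) [L.Structure A] [Nonempty A] (Δ : Set (Fml L))
    (χ : Cardinal.{0}) (lt : HSet χ → HSet χ → Prop) (x : HSet χ) : Prop :=
  ∀ N : setLang.ElementarySubstructure (HModel χ lt), (elems N).Countable → x.1 ∈ elems N →
    ∀ (m : ℕ) (a : Fin m → A), WeaklyDefinable Δ (elems N) a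

/-- The same, without the demand that the elementary submodels are countable. -/
def DefinableOverAll (A : Set (ℕ → ℕ)) [L.Structure A] [Nonempty A] (Δ : Set (Fml L))
    (χ : Cardinal.{0}) (lt : HSet χ → HSet χ → Prop) (x : HSet χ) : Prop :=
  ∀ N : setLang.ElementarySubstructure (HModel χ lt), x.1 ∈ elems N →
    ∀ (m : ℕ) (a : Fin m → A), WeaklyDefinable Δ (elems N) a

/-- `(A, Δ)` is `ℵ₀`-stable. -/
def IsStable (A : Set (ℕ → ℕ)) [L.Structure A] [Nonempty A] (Δ : Set (Fml L)) : Prop :=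
  ∃ χ₀ : Cardinal.{0}, ∀ χ ≥ χ₀, χ.IsRegular →
    ∀ lt : HSet χ → HSet χ → Prop, IsWellOrder (HSet χ) lt →
      ∃ x : HSet χ, DefinableOverCountable A Δ χ lt x

/-- The definition of `ℵ₀`-stability with the demand that `N` is countable omitted. -/
def IsStableAll (A : Set (ℕ → ℕ)) [L.Structure A] [Nonempty A] (Δ : Set (Fml L)) : Prop :=
  ∃ χ₀ : Cardinal.{0}, ∀ χ ≥ χ₀, χ.IsRegular →
    ∀ lt : HSet χ → HSet χ → Prop, IsWellOrder (HSet χ) lt →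
      ∃ x : HSet χ, DefinableOverAll A Δ χ lt x

end stability

/-! ### End-extension indiscernibility -/

section indiscernibility

variable {L : FirstOrder.Language.{0, 0}} {M : Type} [L.Structure M] [Nonempty M]

/-- Finite sequences `l`, `l'` of the same length realize the same `Δ`-type over `P`. -/
def SameType (Δ : Set (Fml L)) (P : Set M) (l l' : List M) : Prop :=
  l.length = l'.length ∧ ∀ φ ∈ Δ, ∀ b : List M, (∀ x ∈ b, x ∈ P) →
    FreeBelow φ (l.length + b.length) → (Holds φ (l ++ b) ↔ Holds φ (l' ++ b))

/-- The concatenation of the tuples `a_{r 0}, …, a_{r (n - 1)}`. -/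
def concat {J : Type*} {m n : ℕ} (a : J → Fin m → M) (r : Fin n → J) : List M :=
  (List.ofFn fun i => List.ofFn (a (r i))).flatten

/-- Two increasing `n₁`-tuples above an increasing `n₀`-tuple look the same over it. -/
def EndExtCondition (Δ : Set (Fml L)) (n₀ n₁ : ℕ) (P : Set M) {J : Type*} [LinearOrder J] {m : ℕ}
    (a : J → Fin m → M) : Prop :=
  ∀ (r : Fin n₀ → J) (s t : Fin n₁ → J), StrictMono r → StrictMono s → StrictMono t →
    (∀ i j, r i < s j) → (∀ i j, r i < t j) →
      SameType Δ P (concat a r ++ concat a s) (concat a r ++ concat a t)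

/-- `⟨a_t : t ∈ J⟩` is `(Δ, n₀, n₁)`-end-extension indiscernible over `P`; if `J` has a last
element then `n₀` and `n₁` may also be decreased. -/
def EndExtIndiscernible₂ (Δ : Set (Fml L)) (n₀ n₁ : ℕ) (P : Set M) {J : Type*} [LinearOrder J]
    {m : ℕ} (a : J → Fin m → M) : Prop :=
  EndExtCondition Δ n₀ n₁ P a ∧
    ((∃ j : J, IsTop j) → ∀ k₀ ≤ n₀, ∀ k₁ ≤ n₁, EndExtCondition Δ k₀ k₁ P a)

/-- `⟨a_t : t ∈ J⟩` is `(Δ, n)`-end-extension indiscernible over `P`.  For `n = 1` this is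
`Δ`-end-extension indiscernibility. -/
def EndExtIndiscernible (Δ : Set (Fml L)) (n : ℕ) (P : Set M) {J : Type*} [LinearOrder J]
    {m : ℕ} (a : J → Fin m → M) : Prop :=
  ∀ n₀ : ℕ, EndExtIndiscernible₂ Δ n₀ n P a

end indiscernibility

end EndExt

end

open EndExt

/-! Countability of N can be omitted by a Löwenheim–Skolem argument. If no c ∈ N predicts the type
of ā, choose for each c ∈ N a pair in N on which c errs, and close a countable N' ≺ N under this
choice. No member of N' then predicts the type over N' (`DefinableOverCountable.definableOverAll`).

For the rest, let B_α consist of P and the entries of a_δ, δ < α, and let C_α be the Skolem hull of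
x and all pairs with parameters in B_α. The C_α form an increasing continuous chain of sets of size
below κ (`exists_chain`). The type of any tuple over B_α is predicted by some c ∈ C_α, and as Δ is
closed under negation, tuples of equal length with the same c have the same type over B_α
(`Decides.sameType`).

Attach to α a list e_n(α) of n members of C_α (`exists_codes`): e_{n+1}(α) extends e_n(α) by one c
predicting over B_α all increasing (n+1)-tuples that start at α and on which e_n is constant. One c
suffices: by induction the tails have the same type over a set containing B_α and a_α, and closure
under permutations moves a_α from the parameters into the tuple. Hence increasing n-tuples with a
common value of e_n have the same type over every B_γ with γ below both.

By continuity these lists are coded by ordinals so that the code of e_n(α) is below α on a club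
(`exists_regressive_coding`). The codes are the f_n, and Fodor's lemma yields stationary fibres. -/

namespace EndExt

/-! ### Clubs and stationary subsets of regular cardinals -/

section clubs

universe v

variable {K : Type v} [LinearOrder K] [WellFoundedLT K] [IsRegularCardinalOrder K]

theorem exists_forall_lt_of_mk_lt {s : Set K} (hs : #s < #K) : ∃ b, ∀ x ∈ s, x < b := by
  rw [← Order.cof_eq_cardinalMk (α := K)] at hs
  have h : ¬ IsCofinal s := fun h => (Order.cof_le h).not_gt hs
  obtain ⟨a, ha⟩ := not_isCofinal_iff.1 h
  exact ⟨a, fun x hx => by simpa using ha x hx⟩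

theorem mk_Iic_lt_of_aleph0_lt (hK : ℵ₀ < #K) (b : K) : #(Set.Iic b) < #K := by
  have h : #(Set.Iio b) < #K := mk_Iio_lt b Cardinal.ord_cardinalMk
  rw [← Set.Iio_insert]
  exact mk_insert_le.trans_lt (add_lt_of_lt hK.le h (one_lt_aleph0.trans hK))

/-- The nonzero points closed under a function form a club. -/
theorem isClub_closurePoints (hK : ℵ₀ < #K) (h : K → K) :
    IsClub {a | (Set.Iio a).Nonempty ∧ ∀ x < a, h x < a} := by
  refine ⟨fun d hd hne _ a ha => ⟨?_, fun x hx => ?_⟩, fun a => ?_⟩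
  · obtain ⟨b, hb⟩ := hne
    obtain ⟨x, hx⟩ := (hd hb).1
    exact ⟨x, lt_of_lt_of_le hx (ha.1 hb)⟩
  · obtain ⟨b, hb, hxb⟩ := (lt_isLUB_iff ha).1 hx
    exact ((hd hb).2 x hxb).trans_le (ha.1 hb)
  · have key : ∀ b, ∃ c, ∀ x ≤ b, h x < c := by
      intro b
      have hc : #(h '' Set.Iic b) < #K := mk_image_le.trans_lt (mk_Iic_lt_of_aleph0_lt hK b)
      obtain ⟨c, hc⟩ := exists_forall_lt_of_mk_lt hc
      exact ⟨c, fun x hx => hc _ ⟨x, hx, rfl⟩⟩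
    choose H hH using key
    have hlt : #(Set.range fun n : ℕ => H^[n] a) < #K := by
      refine lt_of_le_of_lt ?_ hK
      rw [le_aleph0_iff_set_countable]
      exact Set.countable_range _
    obtain ⟨c, hc⟩ := exists_forall_lt_of_mk_lt hlt
    -- The least strict bound of the orbit of `a` under `H`: any `x < l` lies below some iterate,
    -- and the next iterate exceeds `h x`.
    obtain ⟨l, hl, hl'⟩ := WellFounded.has_min (wellFounded_lt (α := K))
      {c | ∀ n : ℕ, H^[n] a < c} ⟨c, fun n => hc _ ⟨n, rfl⟩⟩
    refine ⟨l, ⟨⟨a, hl 0⟩, fun x hx => ?_⟩, (hl 0).le⟩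
    obtain ⟨n, hn⟩ : ∃ n : ℕ, x ≤ H^[n] a := by
      by_contra! hcon
      exact hl' x hcon hx
    have hs := hl (n + 1)
    rw [Function.iterate_succ_apply'] at hs
    exact (hH _ x hn).trans hs

theorem cof_ne_aleph0_of_lt (hK : ℵ₀ < #K) : Order.cof K ≠ ℵ₀ := by
  rw [Order.cof_eq_cardinalMk (α := K)]
  exact hK.ne'

theorem isClub_diagonalInter (hK : ℵ₀ < #K) {C : K → Set K} (hC : ∀ g, IsClub (C g)) :
    IsClub {a | ∀ g < a, a ∈ C g} := by
  refine ⟨fun d hd hne _ a ha g hg => ?_, fun a => ?_⟩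
  · obtain ⟨b, hb, hgb⟩ := (lt_isLUB_iff ha).1 hg
    -- The tail of `d` from `b` on has the same supremum, and its points exceed `g`.
    refine (hC g).isLUB_mem (t := d ∩ Set.Ici b) (fun x hx => hd hx.1 g (hgb.trans_le hx.2))
      ⟨b, hb, le_rfl⟩ ⟨fun x hx => ha.1 hx.1, fun y hy => ha.2 fun x hx => ?_⟩
    rcases le_total b x with h | h
    · exact hy ⟨hx, h⟩
    · exact h.trans (hy ⟨hb, le_rfl⟩)
  · have hI : ∀ b, IsClub (⋂ g : Set.Iic b, C g.1) := fun b => by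
      refine IsClub.iInter (cof_ne_aleph0_of_lt hK) ?_ fun g => hC g.1
      rw [Order.cof_eq_cardinalMk (α := K), Cardinal.lift_lt]
      exact mk_Iic_lt_of_aleph0_lt hK b
    have key : ∀ b, ∃ c, b < c ∧ ∀ g ≤ b, c ∈ C g := by
      intro b
      obtain ⟨b', hb'⟩ := exists_forall_lt_of_mk_lt (mk_Iic_lt_of_aleph0_lt hK b)
      obtain ⟨c, hc, hbc⟩ := (hI b).isCofinal b'
      exact ⟨c, (hb' b le_rfl).trans_le hbc, fun g hg => Set.mem_iInter.1 hc ⟨g, hg⟩⟩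
    choose h hh hhC using key
    obtain ⟨l, ⟨hl, hl'⟩, hal⟩ := (isClub_closurePoints hK h).isCofinal a
    refine ⟨l, fun g hg => ?_, hal⟩
    -- For `g ≤ x < l` the value `h x` lies in `C g` and in `(x, l)`, so `l` is a limit of points of
    -- `C g`.
    refine (hC g).isLUB_mem (t := h '' Set.Ico g l) ?_ ⟨_, g, ⟨le_rfl, hg⟩, rfl⟩ ⟨?_, ?_⟩
    · rintro _ ⟨x, hx, rfl⟩
      exact hhC x g hx.1
    · rintro _ ⟨x, hx, rfl⟩
      exact (hl' x hx.2).le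
    · intro y hy
      by_contra! hyl
      have := hy ⟨max g y, ⟨le_max_left _ _, max_lt hg hyl⟩, rfl⟩
      exact absurd (hh (max g y)) (not_lt.2 (this.trans (le_max_right _ _)))

/-- Fodor's lemma. -/
theorem IsStationary.exists_fiber (hK : ℵ₀ < #K) {S : Set K} (hS : IsStationary S) {f : K → K}
    (hf : ∀ a ∈ S, f a < a) : ∃ g, IsStationary {a | a ∈ S ∧ f a = g} := by
  by_contra! hcon
  simp only [not_isStationary_iff] at hcon
  choose C hC hdis using hcon
  obtain ⟨a, haS, haC⟩ := hS (isClub_diagonalInter hK hC)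
  exact Set.disjoint_left.1 (hdis (f a)) ⟨haS, rfl⟩ (haC _ (hf a haS))

theorem IsStationary.inter_isClub (hK : ℵ₀ < #K) {S E : Set K} (hS : IsStationary S)
    (hE : IsClub E) : IsStationary (S ∩ E) := fun t ht => by
  rw [Set.inter_assoc]
  exact hS (hE.inter (cof_ne_aleph0_of_lt hK) ht)

theorem mk_lists_lt {c : Cardinal.{v}} (hc : ℵ₀ < c) {T : Type v} {C : Set T} (hC : #C < c) :
    #{l : List T | ∀ t ∈ l, t ∈ C} < c := by
  refine lt_of_le_of_lt ?_ ((mk_list_le_max C).trans_lt (max_lt hc hC))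
  refine mk_le_of_surjective (f := fun l : List C => ⟨l.map (↑), by simp +contextual⟩) ?_
  rintro ⟨l, hl⟩
  refine ⟨l.attach.map fun t => ⟨t.1, hl _ t.2⟩, ?_⟩
  simp [Function.comp_def]

/-- Finite sequences from the members of an increasing continuous chain of small sets can be coded
by ordinals so that the code is below the index, on a club. -/
theorem exists_regressive_coding (hK : ℵ₀ < #K) {T : Type v} {C : K → Set T} (hmono : Monotone C)
    (hcont : ∀ a, (Set.Iio a).Nonempty → (∀ x < a, ∃ y < a, x < y) →
      ∀ t ∈ C a, ∃ b < a, t ∈ C b)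
    (hcard : ∀ a, #(C a) < #K) :
    ∃ (g : List T → K) (E : Set K), IsClub E ∧
      Set.InjOn g {l | ∃ a, ∀ t ∈ l, t ∈ C a} ∧
      ∀ a ∈ E, ∀ l : List T, (∀ t ∈ l, t ∈ C a) → g l < a := by
  have hne : Nonempty K := mk_ne_zero_iff.1 (aleph0_pos.trans hK).ne'
  set U : Set (List T) := {l | ∃ a, ∀ t ∈ l, t ∈ C a} with hU
  have hUcard : #U ≤ #K := by
    have : U = ⋃ a, {l : List T | ∀ t ∈ l, t ∈ C a} := by ext; simp [hU]
    rw [this]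
    refine (mk_iUnion_le _).trans ?_
    refine (mul_le_mul' le_rfl (ciSup_le' fun a => (mk_lists_lt hK (hcard a)).le)).trans ?_
    rw [mul_eq_self hK.le]
  obtain ⟨e⟩ := (Cardinal.le_def _ _).1 hUcard
  classical
  let g : List T → K := fun l => if h : l ∈ U then e ⟨l, h⟩ else Classical.arbitrary K
  have hg : Set.InjOn g U := by
    intro l hl l' hl' h
    simp only [g, dif_pos hl, dif_pos hl'] at h
    simpa using e.injective h
  have key : ∀ a, ∃ b, a < b ∧ ∀ l : List T, (∀ t ∈ l, t ∈ C a) → g l < b := by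
    intro a
    obtain ⟨b, hb⟩ := exists_forall_lt_of_mk_lt
      ((mk_image_le (f := g)).trans_lt (mk_lists_lt hK (hcard a)))
    obtain ⟨c, hc⟩ := exists_forall_lt_of_mk_lt (mk_Iic_lt_of_aleph0_lt hK a)
    exact ⟨max b c, lt_max_of_lt_right (hc a le_rfl),
      fun l hl => lt_max_of_lt_left (hb _ ⟨l, hl, rfl⟩)⟩
  choose h hlt hh using key
  refine ⟨g, _, isClub_closurePoints hK h, hg, ?_⟩
  rintro a ⟨ha, ha'⟩ l hl
  -- Being closed under `h`, `a` is a limit, so the finitely many entries of `l` all appear at one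
  -- earlier stage. The empty list needs `a` not to be least.
  obtain ⟨b, hba, hb⟩ : ∃ b < a, ∀ t ∈ l, t ∈ C b := by
    induction l with
    | nil =>
      obtain ⟨b, hb⟩ := ha
      exact ⟨b, hb, by simp⟩
    | cons t l ih =>
      obtain ⟨b, hba, hb⟩ := ih fun t ht => hl t (by simp [ht])
      obtain ⟨c, hca, hc⟩ := hcont a ha (fun x hx => ⟨h x, ha' x hx, hlt x⟩) t (hl t (by simp))
      refine ⟨max b c, max_lt hba hca, fun u hu => ?_⟩
      rcases List.mem_cons.1 hu with rfl | hu
      · exact hmono (le_max_right _ _) hc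
      · exact hmono (le_max_left _ _) (hb u hu)
  exact (hh b l hb).trans (ha' b hba)

/-- Regular cardinals, as sets of ordinals in the next universe. -/
theorem isRegularCardinalOrder_Iio_ord {κ : Cardinal.{v}} (hκ : κ.IsRegular) :
    IsRegularCardinalOrder (Set.Iio κ.ord) := by
  refine ⟨?_⟩
  rw [Ordinal.cof_Iio, ← Ordinal.lift_cof, hκ.cof_ord, ← Cardinal.lift_ord]
  exact (Ordinal.typein_ordinal κ.ord).le

theorem mk_Iio_ord_eq_lift (κ : Cardinal.{v}) : #(Set.Iio κ.ord) = Cardinal.lift.{v + 1} κ := by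
  simp

end clubs
/-! ### Elementary submodels -/

section submodels

open FirstOrder FirstOrder.Language FirstOrder.Language.Substructure

universe w

theorem countable_functions_sum_skolem₁ (L : FirstOrder.Language.{0, 0}) (hL : L.card ≤ ℵ₀) :
    Countable (Σ n, (L.sum L.skolem₁).Functions n) :=
  mk_le_aleph0_iff.1 (card_functions_sum_skolem₁_le.trans (max_le le_rfl hL))

/-- Skolem closure and closure under `p` alternate ω times; the union is closed under both. -/
theorem exists_countable_elementarySubstructure_closed {L : FirstOrder.Language.{0, 0}} (hL : L.card ≤ ℵ₀)
    {M : Type w} [Nonempty M] [L.Structure M] (p : M → M) (x : M) :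
    ∃ N : L.ElementarySubstructure M, (N : Set M).Countable ∧ x ∈ N ∧ ∀ y ∈ N, p y ∈ N := by
  have hc := countable_functions_sum_skolem₁ L hL
  obtain ⟨S, hS0, hS⟩ : ∃ S : ℕ → (L.sum L.skolem₁).Substructure M,
      S 0 = closure (L.sum L.skolem₁) {x} ∧
      ∀ n, S (n + 1) = closure (L.sum L.skolem₁) ((S n : Set M) ∪ p '' (S n : Set M)) :=
    ⟨fun n => Nat.rec (motive := fun _ => (L.sum L.skolem₁).Substructure M)
      (closure (L.sum L.skolem₁) {x})
      (fun _ T => closure (L.sum L.skolem₁) ((T : Set M) ∪ p '' (T : Set M))) n,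
      rfl, fun _ => rfl⟩
  have hmono : Monotone S := monotone_nat_of_le_succ fun n => by
    rw [hS]
    exact fun y hy => subset_closure (Or.inl hy)
  have hcount : ∀ n, (S n : Set M).Countable := by
    intro n
    induction n with
    | zero =>
      rw [hS0]
      exact Set.countable_coe_iff.1
        ((Set.countable_singleton x).substructure_closure (L := L.sum L.skolem₁))
    | succ n ih =>
      rw [hS]
      exact Set.countable_coe_iff.1
        ((ih.union (ih.image p)).substructure_closure (L := L.sum L.skolem₁))
  have hmem : ∀ y, y ∈ (⨆ n, S n) ↔ ∃ n, y ∈ S n := fun y =>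
    mem_iSup_of_directed hmono.directed_le
  refine ⟨(⨆ n, S n).elementarySkolem₁Reduct, ?_, ?_, ?_⟩
  · refine (Set.countable_iUnion hcount).mono fun y hy => ?_
    exact Set.mem_iUnion.2 ((hmem y).1 hy)
  · refine (hmem x).2 ⟨0, ?_⟩
    rw [hS0]
    exact subset_closure rfl
  · intro y hy
    obtain ⟨n, hn⟩ := (hmem y).1 hy
    refine (hmem _).2 ⟨n + 1, ?_⟩
    rw [hS]
    exact subset_closure (Or.inr ⟨y, hn, rfl⟩)

/-- Transitivity of ≺. -/
theorem exists_elementarySubstructure_image {L : FirstOrder.Language.{0, 0}} {M : Type w} [L.Structure M]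
    (N : L.ElementarySubstructure M) (N' : L.ElementarySubstructure N) :
    ∃ N'' : L.ElementarySubstructure M, ∀ y : M, y ∈ N'' ↔ ∃ h : y ∈ N, (⟨y, h⟩ : N) ∈ N' := by
  let T : L.Substructure M := N'.toSubstructure.map N.subtype.toEmbedding.toHom
  have hT : ∀ y : M, y ∈ T ↔ ∃ h : y ∈ N, (⟨y, h⟩ : N) ∈ N' := by
    intro y
    refine mem_map.trans ⟨?_, ?_⟩
    · rintro ⟨z, hz, rfl⟩
      exact ⟨z.2, hz⟩
    · rintro ⟨h, hy⟩
      exact ⟨⟨y, h⟩, hy, rfl⟩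
  refine ⟨⟨T, fun n φ x => ?_⟩, hT⟩
  let e : N' ≃[L] T :=
    { toFun := fun z => ⟨z.1.1, (hT _).2 ⟨z.1.2, z.2⟩⟩
      invFun := fun y => ⟨⟨y.1, ((hT _).1 y.2).1⟩, ((hT _).1 y.2).2⟩
      left_inv := fun z => rfl
      right_inv := fun y => rfl
      map_fun' := fun f v => rfl
      map_rel' := fun r v => Iff.rfl }
  have h1 := N'.isElementary φ (e.symm ∘ x)
  have h2 := N.isElementary φ (((↑) : N' → N) ∘ e.symm ∘ x)
  have h3 := StrongHomClass.realize_formula e φ (v := e.symm ∘ x)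
  have h4 : e ∘ e.symm ∘ x = x := by ext i; simp
  rw [h4] at h3
  exact (h3.trans (h1.symm.trans h2.symm)).symm

end submodels

/-! ### Omitting countability of the submodels -/

section stability

variable {L : FirstOrder.Language.{0, 0}} {A : Set (ℕ → ℕ)} [L.Structure A] [Nonempty A]
  [Countable L.Symbols]

theorem card_setLang_le : setLang.card ≤ ℵ₀ := by
  rw [FirstOrder.Language.card, mk_le_aleph0_iff]
  have : Finite (Σ l, setLang.Relations l) :=
    Finite.of_surjective (fun b : Bool => if b then ⟨2, SetRel.mem⟩ else ⟨2, SetRel.lt⟩) (by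
      rintro ⟨_, _ | _⟩
      · exact ⟨true, rfl⟩
      · exact ⟨false, rfl⟩)
  have : IsEmpty (Σ l, setLang.Functions l) := ⟨fun f => nomatch f.2⟩
  unfold FirstOrder.Language.Symbols
  infer_instance

/-- If a type is weakly definable over no countable elementary submodel of `N`, then it is not
weakly definable over `N`. -/
theorem DefinableOverCountable.definableOverAll {Δ : Set (Fml L)} {χ : Cardinal.{0}}
    {lt : HSet χ → HSet χ → Prop} {x : HSet χ} (h : DefinableOverCountable A Δ χ lt x) :
    DefinableOverAll A Δ χ lt x := by
  intro N hx m a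
  by_contra hcon
  -- `q c` is a pair in `N` on which the predictor `c` errs; if `c` is not a function on Φ^m, it is
  -- the dummy value `c`.
  have key : ∀ c : N, ∃ q : N, ZFSet.IsFunc (PhiSet A Δ m) (natSet 2) c.1.1 →
      ∃ p : PhiPair (A := A) Δ m, p.toSet = q.1.1 ∧
      ∃ l : Fin 2, Holds (p.φ l) (List.ofFn a ++ p.b) ∧ ZFSet.pair p.toSet (natSet l) ∉ c.1.1 := by
    intro c
    by_cases hc : ZFSet.IsFunc (PhiSet A Δ m) (natSet 2) c.1.1
    · by_contra! hq
      refine hcon ⟨c.1.1, ⟨c.1, c.2, rfl⟩, hc, ?_⟩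
      rintro p ⟨y, hy, hyp⟩ l hl
      exact ((hq ⟨y, hy⟩).2 p hyp.symm) l hl
    · exact ⟨c, fun h => absurd h hc⟩
  choose q hq using key
  obtain ⟨y, hy, hyx⟩ := hx
  have : Nonempty N := ⟨⟨y, hy⟩⟩
  obtain ⟨N', hN', hyN', hclosed⟩ :=
    exists_countable_elementarySubstructure_closed card_setLang_le q (⟨y, hy⟩ : N)
  obtain ⟨N'', hN''⟩ := exists_elementarySubstructure_image N N'
  have hcount : (elems N'').Countable := by
    refine (hN'.image fun z : N => z.1.1).mono ?_
    rintro _ ⟨z, hz, rfl⟩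
    obtain ⟨h1, h2⟩ := (hN'' z).1 hz
    exact ⟨⟨z, h1⟩, h2, rfl⟩
  obtain ⟨_, ⟨z, hz, rfl⟩, hfunc, hc⟩ :=
    h N'' hcount ⟨y, (hN'' y).2 ⟨hy, hyN'⟩, hyx⟩ m a
  obtain ⟨h1, h2⟩ := (hN'' z).1 hz
  obtain ⟨p, hp, l, hl, hpl⟩ := hq ⟨z, h1⟩ hfunc
  refine hpl (hc p ⟨(q ⟨z, h1⟩).1, (hN'' _).2 ⟨_, hclosed _ h2⟩, hp.symm⟩ l hl)

theorem IsStable.isStableAll {Δ : Set (Fml L)} (h : IsStable A Δ) : IsStableAll A Δ := by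
  obtain ⟨χ₀, h⟩ := h
  refine ⟨χ₀, fun χ hχ hreg lt hlt => ?_⟩
  obtain ⟨x, hx⟩ := h χ hχ hreg lt hlt
  exact ⟨x, hx.definableOverAll⟩

end stability

/-! ### Renaming of variables -/

section substitution

variable {L : FirstOrder.Language.{0, 0}}

theorem InfFormula.realize_rename {M : Type} [L.Structure M] (σ : ℕ → ℕ) {n : ℕ}
    (φ : InfFormula L n) (v : ℕ → M) (xs : Fin n → M) :
    (φ.rename σ).Realize v xs ↔ φ.Realize (v ∘ σ) xs := by
  have hσ : ∀ {n : ℕ} (xs : Fin n → M),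
      Sum.elim v xs ∘ Sum.map σ id = Sum.elim (v ∘ σ) xs := fun xs => by
    rw [Sum.elim_comp_map, Function.comp_id]
  induction φ with
  | equal t s => simp [rename, Realize, hσ]
  | rel R ts => simp [rename, Realize, hσ]
  | neg φ ih => simp [rename, Realize, ih]
  | conj φ ih => simp [rename, Realize, ih]
  | ex φ ih => simp [rename, Realize, ih]
  | exUncountable φ ih => simp [rename, Realize, ih]

theorem varFinsetLeft_relabel_subset (σ : ℕ → ℕ) {n : ℕ} (t : L.Term (ℕ ⊕ Fin n)) :
    ((t.relabel (Sum.map σ id)).varFinsetLeft : Set ℕ) ⊆ σ '' t.varFinsetLeft := by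
  induction t with
  | var x =>
    rcases x with i | j
    · simp [FirstOrder.Language.Term.varFinsetLeft]
    · simp [FirstOrder.Language.Term.varFinsetLeft]
  | func f ts ih =>
    intro i hi
    simp only [FirstOrder.Language.Term.relabel, FirstOrder.Language.Term.varFinsetLeft,
      Finset.coe_biUnion, Set.mem_iUnion] at hi ⊢
    obtain ⟨j, -, hj⟩ := hi
    obtain ⟨k, hk, rfl⟩ := ih j hj
    exact ⟨k, Set.mem_iUnion.2 ⟨j, Set.mem_iUnion.2 ⟨by simp, hk⟩⟩, rfl⟩

theorem InfFormula.freeVars_rename_subset (σ : ℕ → ℕ) {n : ℕ} (φ : InfFormula L n) :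
    (φ.rename σ).freeVars ⊆ σ '' φ.freeVars := by
  induction φ with
  | equal t s =>
    simp only [rename, freeVars, Set.image_union]
    exact Set.union_subset_union (varFinsetLeft_relabel_subset σ t)
      (varFinsetLeft_relabel_subset σ s)
  | rel R ts =>
    simp only [rename, freeVars, Set.image_iUnion]
    exact Set.iUnion_mono fun i => varFinsetLeft_relabel_subset σ (ts i)
  | neg φ ih => simpa [rename, freeVars] using ih
  | conj φ ih =>
    simp only [rename, freeVars, Set.image_iUnion]
    exact Set.iUnion_mono ih
  | ex φ ih => simpa [rename, freeVars] using ih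
  | exUncountable φ ih => simpa [rename, freeVars] using ih

/-- The permutation of the variables which moves the first `p` ones behind the next `q` ones. -/
def blockSwap (p q : ℕ) : Equiv.Perm ℕ where
  toFun i := if i < p then q + i else if i < p + q then i - p else i
  invFun i := if i < q then p + i else if i < p + q then i - q else i
  left_inv i := by dsimp only; split_ifs <;> omega
  right_inv i := by dsimp only; split_ifs <;> omega

theorem getD_blockSwap {M : Type*} (u l b : List M) (d : M) (i : ℕ) :
    (l ++ (u ++ b)).getD (blockSwap u.length l.length i) d = ((u ++ l) ++ b).getD i d := by
  simp only [blockSwap, Equiv.coe_fn_mk, List.getD_eq_getElem?_getD, List.getElem?_append,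
    List.length_append]
  congr 1
  split_ifs <;> first | omega | rfl | (congr 1; omega)

theorem FreeBelow.rename_blockSwap {φ : Fml L} {p q r : ℕ} (h : FreeBelow φ (p + q + r)) :
    FreeBelow (φ.rename (blockSwap p q)) (q + (p + r)) := by
  intro i hi
  obtain ⟨j, hj, rfl⟩ := InfFormula.freeVars_rename_subset _ _ hi
  have := h hj
  simp only [Set.mem_Iio, blockSwap, Equiv.coe_fn_mk] at this ⊢
  split_ifs <;> omega

end substitution

/-! ### Types over parameters -/

section types

variable {L : FirstOrder.Language.{0, 0}} {M : Type} [L.Structure M] [Nonempty M]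

theorem holds_rename_blockSwap (φ : Fml L) (u l b : List M) :
    Holds (φ.rename (blockSwap u.length l.length)) (l ++ (u ++ b)) ↔ Holds φ ((u ++ l) ++ b) := by
  unfold Holds
  rw [InfFormula.realize_rename]
  have : (fun i => (l ++ (u ++ b)).getD i (Classical.arbitrary M)) ∘
      (blockSwap u.length l.length) =
      fun i => ((u ++ l) ++ b).getD i (Classical.arbitrary M) :=
    funext fun i => getD_blockSwap u l b _ i
  rw [this]

theorem SameType.refl (Δ : Set (Fml L)) (B : Set M) (l : List M) : SameType Δ B l l :=
  ⟨rfl, fun _ _ _ _ _ => Iff.rfl⟩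

/-- Parameters may be moved into the sequences. -/
theorem SameType.append_left {Δ : Set (Fml L)} (hΔ : ClosedUnderPerm Δ) {B B' : Set M}
    {l l' u : List M} (h : SameType Δ B' l l') (hB : B ⊆ B') (hu : ∀ x ∈ u, x ∈ B') :
    SameType Δ B (u ++ l) (u ++ l') := by
  refine ⟨by simp [h.1], fun φ hφ b hb hfree => ?_⟩
  rw [List.length_append] at hfree
  -- Read φ(u, l, b) as a formula in l with parameters u, b. The permutation depends only on
  -- lengths, so it serves `l'` too.
  rw [← holds_rename_blockSwap φ u l b, ← holds_rename_blockSwap φ u l' b, ← h.1]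
  refine h.2 _ (hΔ _ φ hφ) (u ++ b) (fun x hx => ?_) ?_
  · rcases List.mem_append.1 hx with hx | hx
    exacts [hu x hx, hB (hb x hx)]
  · rw [List.length_append]
    exact hfree.rename_blockSwap

/-- Since φ and ¬¬φ are identified, the negation may be found by removing a negation sign from φ. -/
theorem ClosedUnderNeg.exists_holds_iff_not {Δ : Set (Fml L)} (hΔ : ClosedUnderNeg Δ) {φ : Fml L} (hφ : φ ∈ Δ) :
    ∃ ψ ∈ Δ, ψ.freeVars = φ.freeVars ∧ ∀ l : List M, Holds ψ l ↔ ¬ Holds φ l := by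
  obtain ⟨ψ, hψ, rfl | rfl⟩ := hΔ φ hφ
  · exact ⟨_, hψ, rfl, fun l => Iff.rfl⟩
  · exact ⟨_, hψ, rfl, fun l => not_not.symm⟩

end types

theorem length_concat {M : Type} {J : Type*} {m n : ℕ} (a : J → Fin m → M) (s : Fin n → J) :
    (concat a s).length = n * m := by
  simp [concat, List.length_flatten, List.map_ofFn, Function.comp_def]

theorem concat_succ {M : Type} {J : Type*} {m n : ℕ} (a : J → Fin m → M) (s : Fin (n + 1) → J) :
    concat a s = List.ofFn (a (s 0)) ++ concat a (Fin.tail s) := by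
  simp [concat, List.ofFn_succ, Fin.tail]

theorem mem_concat {M : Type} {J : Type*} {m n : ℕ} {a : J → Fin m → M} {s : Fin n → J} {x : M} :
    x ∈ concat a s ↔ ∃ i j, a (s i) j = x := by
  simp [concat, List.mem_ofFn]

/-! ### Predicting functions and the codes built from them -/

section decides

variable {L : FirstOrder.Language.{0, 0}} {A : Set (ℕ → ℕ)} [L.Structure A] [Nonempty A]
  [Countable L.Symbols]

/-- `c` is a function from `Φ^k` to `{0, 1}` which predicts correctly which formulas with
parameters in `B` the sequence `l` satisfies. -/
def Decides (Δ : Set (Fml L)) (B : Set A) (c : ZFSet.{0}) (k : ℕ) (l : List A) : Prop :=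
  ZFSet.IsFunc (PhiSet A Δ k) (natSet 2) c ∧
    ∀ p : PhiPair (A := A) Δ k, (∀ x ∈ p.b, x ∈ B) →
      ∀ i : Fin 2, Holds (p.φ i) (l ++ p.b) → ZFSet.pair p.toSet (natSet i) ∈ c

variable {Δ : Set (Fml L)} {B B' : Set A} {c : ZFSet.{0}} {k : ℕ} {l l' : List A}

theorem Decides.mono (h : Decides Δ B' c k l) (hB : B ⊆ B') : Decides Δ B c k l :=
  ⟨h.1, fun p hp => h.2 p fun x hx => hB (hp x hx)⟩

theorem Decides.congr (h : Decides Δ B c k l) (hl : l.length = k) (hll' : SameType Δ B l l') :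
    Decides Δ B c k l' :=
  ⟨h.1, fun p hp i hi => h.2 p hp i
    ((hll'.2 _ (p.mem i) p.b hp (by rw [hl]; exact p.free i)).2 hi)⟩

theorem natSet_injective : Function.Injective natSet := fun i j h => by
  simpa using Ordinal.toZFSet_injective h

/-- The pair (φ, ¬φ) belongs to Φ^k and `c` is single-valued there, so its value settles φ for both
tuples. -/
theorem Decides.sameType (hΔ : ClosedUnderNeg Δ) (h : Decides Δ B c k l) (h' : Decides Δ B c k l')
    (hl : l.length = k) (hl' : l'.length = k) : SameType Δ B l l' := by
  refine ⟨hl.trans hl'.symm, fun φ hφ b hb hfree => ?_⟩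
  rw [hl] at hfree
  obtain ⟨ψ, hψ, hfv, hneg⟩ := hΔ.exists_holds_iff_not (M := A) hφ
  let p : PhiPair (A := A) Δ k :=
    { φ := ![φ, ψ]
      b := b
      mem := by
        intro i
        fin_cases i
        exacts [hφ, hψ]
      free := by
        intro i
        fin_cases i
        · exact hfree
        · exact hfv.subset.trans hfree
      contradictory := by
        rintro ⟨x, h0, h1⟩
        exact (hneg _).1 h1 h0 }
  have huniq : ¬ (ZFSet.pair p.toSet (natSet 0) ∈ c ∧ ZFSet.pair p.toSet (natSet 1) ∈ c) := by
    rintro ⟨h0, h1⟩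
    obtain ⟨w, -, hw⟩ := h.1.2 p.toSet (ZFSet.mem_range.2 ⟨p, rfl⟩)
    exact zero_ne_one (natSet_injective ((hw _ h0).trans (hw _ h1).symm))
  constructor
  · intro h0
    by_contra h1
    exact huniq ⟨h.2 p hb 0 h0, h'.2 p hb 1 ((hneg _).2 h1)⟩
  · intro h0
    by_contra h1
    exact huniq ⟨h'.2 p hb 0 h0, h.2 p hb 1 ((hneg _).2 h1)⟩

theorem WeaklyDefinable.exists_decides {N : Set ZFSet.{0}} {l : List A}
    (h : WeaklyDefinable Δ N l.get)
    (hN : ∀ p : PhiPair (A := A) Δ l.length, (∀ x ∈ p.b, x ∈ B) → p.toSet ∈ N) :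
    ∃ c ∈ N, Decides Δ B c l.length l := by
  obtain ⟨c, hc, hfunc, h⟩ := h
  refine ⟨c, hc, hfunc, fun p hp i hi => h p (hN p hp) i ?_⟩
  rwa [List.ofFn_get]

/-- If the type of every tuple over `B α` is predicted by a member of `C α`, then the types of
increasing tuples over `B α` only depend on finitely many members of `C α`. -/
theorem exists_codes {K : Type*} [LinearOrder K] {T : Type*} (z : T → ZFSet.{0}) {C : K → Set T}
    {B : K → Set A} (hB : Monotone B) {m : ℕ} {a : K → Fin m → A}
    (ha : ∀ δ α, δ < α → ∀ i, a δ i ∈ B α) (hneg : ClosedUnderNeg Δ) (hperm : ClosedUnderPerm Δ)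
    (hdec : ∀ α (l : List A), ∃ t ∈ C α, Decides Δ (B α) (z t) l.length l) :
    ∃ e : ℕ → K → List T, (∀ n α, ∀ t ∈ e n α, t ∈ C α) ∧
      (∀ n α β, e (n + 1) α = e (n + 1) β → e n α = e n β) ∧
      ∀ n (s t : Fin n → K), StrictMono s → StrictMono t → (∀ i j, e n (s i) = e n (t j)) →
        ∀ γ, (∀ i, γ ≤ s i) → (∀ i, γ ≤ t i) → SameType Δ (B γ) (concat a s) (concat a t) := by
  classical
  let good (n : ℕ) (e : K → List T) (α : K) (t : T) : Prop := ∀ s : Fin (n + 1) → K,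
    StrictMono s → s 0 = α → (∀ i, e (s i) = e α) →
      Decides Δ (B α) (z t) ((n + 1) * m) (concat a s)
  -- A choice made uniformly in `e`, so that the recursion can be defined before good predictors are
  -- shown to exist.
  have hstep : ∀ (n : ℕ) (e : K → List T) (α : K), ∃ t ∈ C α,
      (∃ t ∈ C α, good n e α t) → good n e α t := by
    intro n e α
    by_cases h : ∃ t ∈ C α, good n e α t
    · obtain ⟨t, ht, ht'⟩ := h
      exact ⟨t, ht, fun _ => ht'⟩
    · obtain ⟨t, ht, -⟩ := hdec α []
      exact ⟨t, ht, fun h' => absurd h' h⟩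
  choose D hDC hD using hstep
  obtain ⟨e, he0, he⟩ : ∃ e : ℕ → K → List T, (∀ α, e 0 α = []) ∧
      ∀ n α, e (n + 1) α = D n (e n) α :: e n α :=
    ⟨fun n => Nat.rec (motive := fun _ => K → List T) (fun _ => [])
      (fun n e α => D n e α :: e α) n, fun _ => rfl, fun _ _ => rfl⟩
  have hdown : ∀ n α β, e (n + 1) α = e (n + 1) β → e n α = e n β := fun n α β h => by
    rw [he, he] at h
    exact (List.cons.inj h).2
  refine ⟨e, fun n => ?_, hdown, fun n => ?_⟩
  · induction n with
    | zero => simp [he0]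
    | succ n ih =>
      intro α t ht
      rw [he] at ht
      rcases List.mem_cons.1 ht with rfl | ht
      exacts [hDC _ _ _, ih α t ht]
  · induction n with
    | zero =>
      intro s t _ _ _ γ _ _
      rw [Subsingleton.elim s t]
      exact SameType.refl _ _ _
    | succ n ih =>
      have hgood : ∀ α, good n (e n) α (D n (e n) α) := by
        intro α
        refine hD n (e n) α ?_
        by_cases hs : ∃ s : Fin (n + 1) → K, StrictMono s ∧ s 0 = α ∧ ∀ i, e n (s i) = e n α
        · obtain ⟨s, hs, hs0, hse⟩ := hs
          obtain ⟨t, ht, hdt⟩ := hdec α (concat a s)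
          rw [length_concat] at hdt
          refine ⟨t, ht, fun s' hs' hs0' hse' => hdt.congr (length_concat a s) ?_⟩
          rw [concat_succ, concat_succ, hs0, hs0']
          rcases n with - | n
          · rw [Subsingleton.elim (Fin.tail s) (Fin.tail s')]
            exact SameType.refl _ _ _
          -- Both tails lie at or above this minimum, so the induction hypothesis compares them over
          -- a set that already contains the entries of `a α`.
          have hlt : α < min (s 1) (s' 1) := lt_min (hs0 ▸ hs (by simp)) (hs0' ▸ hs' (by simp))
          refine SameType.append_left hperm (B' := B (min (s 1) (s' 1)))
            (ih _ _ (fun i j h => hs (by simpa using h)) (fun i j h => hs' (by simpa using h))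
              (fun i j => (hse _).trans (hse' _).symm) _
              (fun i => (min_le_left _ _).trans (hs.monotone ?_))
              (fun i => (min_le_right _ _).trans (hs'.monotone ?_))) (hB hlt.le) ?_
          · exact Fin.succ_le_succ_iff.2 (Fin.zero_le i)
          · exact Fin.succ_le_succ_iff.2 (Fin.zero_le i)
          · intro x hx
            obtain ⟨i, rfl⟩ := List.mem_ofFn.1 hx
            exact ha _ _ hlt i
        · obtain ⟨t, ht, -⟩ := hdec α []
          exact ⟨t, ht, fun s h1 h2 h3 => absurd ⟨s, h1, h2, h3⟩ hs⟩
      intro s t hs ht hst γ hγs hγt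
      have h0 := hst 0 0
      rw [he, he] at h0
      have hds := hgood (s 0) s hs rfl fun i =>
        (hdown _ _ _ (hst i 0)).trans (hdown _ _ _ (hst 0 0)).symm
      have hdt := hgood (t 0) t ht rfl fun i =>
        (hdown _ _ _ (hst 0 i)).symm.trans (hdown _ _ _ (hst 0 0))
      -- The heads of the two lists agree, so one function predicts both tuples.
      rw [(List.cons.inj h0).1] at hds
      exact (hds.mono (hB (hγs 0))).sameType hneg (hdt.mono (hB (hγt 0)))
        (length_concat a s) (length_concat a t)

end decides

/-! ### Cardinality bounds and continuity for the hulls -/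

/-- A level of the von Neumann hierarchy is a transitive set containing every `f i`; a successor
cardinal above its size is regular. -/
theorem exists_regular_forall_mem_HSet {ι : Type} (f : ι → ZFSet.{0}) (χ₀ : Cardinal.{0}) :
    ∃ χ ≥ χ₀, χ.IsRegular ∧ ∀ i, f i ∈ HSet χ := by
  set t := ZFSet.vonNeumann (ZFSet.range f).rank with ht
  refine ⟨Order.succ (max χ₀ (max ℵ₀ t.card)), (le_max_left _ _).trans (Order.le_succ _),
    isRegular_succ ((le_max_left _ _).trans (le_max_right _ _)), fun i => ⟨t, ?_, ?_, ?_⟩⟩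
  · exact ZFSet.isTransitive_vonNeumann _
  · exact (ZFSet.isTransitive_vonNeumann _).subset_of_mem
      (ZFSet.subset_vonNeumann_self _ (ZFSet.mem_range.2 ⟨i, rfl⟩))
  · exact Order.lt_succ_iff.2 ((le_max_right _ _).trans (le_max_right _ _))

section params

variable {A : Set (ℕ → ℕ)}

/-- The parameters in `P` and the members of the tuples with index below `β`. -/
abbrev paramsBelow {K : Type*} [LinearOrder K] {m : ℕ} (P : Set A) (a : K → Fin m → A) (β : K) :
    Set A :=
  P ∪ {y | ∃ δ < β, ∃ i, a δ i = y}

theorem paramsBelow_mono {K : Type*} [LinearOrder K] {m : ℕ} (P : Set A) (a : K → Fin m → A) :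
    Monotone (paramsBelow P a) := fun _ _ h =>
  Set.union_subset_union_right _ fun _ ⟨δ, hδ, hy⟩ => ⟨δ, hδ.trans_le h, hy⟩

theorem mk_paramsBelow_lt {κ : Cardinal.{0}} (hκ : ℵ₀ < κ) (hreg : κ.IsRegular) {m : ℕ}
    {P : Set A} (hP : #P < κ) (a : Set.Iio κ.ord → Fin m → A) (β : Set.Iio κ.ord) :
    #(paramsBelow P a β) < κ := by
  have := isRegularCardinalOrder_Iio_ord hreg
  refine (mk_union_le _ _).trans_lt (add_lt_of_lt hκ.le hP ?_)
  rw [← Cardinal.lift_lt.{0, 1}]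
  have h1 : #(Set.Iio β) < Cardinal.lift.{1} κ :=
    (mk_Iio_lt β Cardinal.ord_cardinalMk).trans_eq (mk_Iio_ord_eq_lift κ)
  have h2 : {y | ∃ δ < β, ∃ i, a δ i = y} =
      Set.range fun q : Set.Iio β × Fin m => a q.1 q.2 := by
    ext y
    simp
  rw [h2]
  have hκ' : ℵ₀ < Cardinal.lift.{1} κ := by simpa using hκ
  refine lt_of_le_of_lt (mk_range_le_lift) ?_
  rw [Cardinal.lift_id', mk_prod]
  refine mul_lt_of_lt hκ'.le ?_ ?_
  · simpa using h1
  · refine lt_trans ?_ hκ'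
    simp

/-- Finitely many parameters appear before a limit; this makes the chain of hulls continuous. -/
theorem exists_subset_paramsBelow {K : Type*} [LinearOrder K] {m : ℕ} {P : Set A}
    {a : K → Fin m → A} {α : K} (hne : (Set.Iio α).Nonempty) (hlim : ∀ x < α, ∃ y < α, x < y)
    {l : List A} (hl : ∀ y ∈ l, y ∈ paramsBelow P a α) :
    ∃ β < α, ∀ y ∈ l, y ∈ paramsBelow P a β := by
  induction l with
  | nil =>
    obtain ⟨β, hβ⟩ := hne
    exact ⟨β, hβ, by simp⟩
  | cons x l ih =>
    obtain ⟨β, hβ, h⟩ := ih fun y hy => hl y (List.mem_cons_of_mem _ hy)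
    obtain ⟨γ, hγ, hx⟩ : ∃ γ < α, x ∈ paramsBelow P a γ := by
      rcases hl x List.mem_cons_self with hx | ⟨δ, hδ, i, rfl⟩
      · exact ⟨β, hβ, Or.inl hx⟩
      · obtain ⟨γ, hγ, hδγ⟩ := hlim δ hδ
        exact ⟨γ, hγ, Or.inr ⟨δ, hδγ, i, rfl⟩⟩
    refine ⟨max β γ, max_lt hβ hγ, fun y hy => ?_⟩
    rcases List.mem_cons.1 hy with rfl | hy
    · exact paramsBelow_mono P a (le_max_right _ _) hx
    · exact paramsBelow_mono P a (le_max_left _ _) (h y hy)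

end params

section pairs

variable {L : FirstOrder.Language.{0, 0}} {A : Set (ℕ → ℕ)} [L.Structure A] [Nonempty A]
  {Δ : Set (Fml L)}

/-- The pairs from the families `Φ^k` with parameters in `B`. -/
abbrev PairsOver (Δ : Set (Fml L)) (B : Set A) : Type :=
  {p : Σ k, PhiPair (A := A) Δ k // ∀ y ∈ p.2.b, y ∈ B}

/-- A pair is determined by k, its two formulas and their common parameter sequence. -/
theorem mk_pairsOver_lt (hΔ : Δ.Countable) {κ : Cardinal.{0}} (hκ : ℵ₀ < κ) {B : Set A}
    (hB : #B < κ) : #(PairsOver Δ B) < κ := by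
  have hΔ' : #Δ < κ := (le_aleph0_iff_set_countable.2 hΔ).trans_lt hκ
  have h : #(ℕ × Δ × Δ × {l : List A | ∀ y ∈ l, y ∈ B}) < κ := by
    simp only [mk_prod, lift_id, mk_nat]
    exact mul_lt_of_lt hκ.le hκ (mul_lt_of_lt hκ.le hΔ' (mul_lt_of_lt hκ.le hΔ'
      (mk_lists_lt hκ hB)))
  refine lt_of_le_of_lt (mk_le_of_injective (f := fun p : PairsOver Δ B =>
    ((p.1.1, ⟨_, p.1.2.mem 0⟩, ⟨_, p.1.2.mem 1⟩, ⟨p.1.2.b, p.2⟩) :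
      ℕ × Δ × Δ × {l : List A | ∀ y ∈ l, y ∈ B})) ?_) h
  rintro ⟨⟨k, p⟩, hp⟩ ⟨⟨k', q⟩, hq⟩ h
  simp only [Prod.mk.injEq, Subtype.mk.injEq] at h
  obtain ⟨rfl, h0, h1, hb⟩ := h
  have hφ : p.φ = q.φ := by
    ext i
    fin_cases i
    exacts [h0, h1]
  obtain ⟨φ, b, _, _, _⟩ := p
  obtain ⟨φ', b', _, _, _⟩ := q
  obtain rfl : φ = φ' := hφ
  obtain rfl : b = b' := hb
  rfl

end pairs

/-! ### The chain of Skolem hulls and the regressive functions -/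

section hulls

open FirstOrder FirstOrder.Language FirstOrder.Language.Substructure

variable {L : FirstOrder.Language.{0, 0}} {A : Set (ℕ → ℕ)} [L.Structure A] [Nonempty A]
  [Countable L.Symbols] {Δ : Set (Fml L)}

/-- A continuous chain of small sets which contain functions predicting all `Δ`-types. -/
theorem exists_chain (hΔ : Δ.Countable) (hstable : IsStable A Δ) {κ : Cardinal.{0}} (hκ : ℵ₀ < κ)
    (hreg : κ.IsRegular) {m : ℕ} {P : Set A} (hP : #P < κ) (a : Set.Iio κ.ord → Fin m → A) :
    ∃ (T : Type 1) (z : T → ZFSet.{0}) (C : Set.Iio κ.ord → Set T), Monotone C ∧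
      (∀ α, (Set.Iio α).Nonempty → (∀ x < α, ∃ y < α, x < y) → ∀ t ∈ C α, ∃ β < α, t ∈ C β) ∧
      (∀ α, #(C α) < #(Set.Iio κ.ord)) ∧
      ∀ α (l : List A), ∃ t ∈ C α, Decides Δ (paramsBelow P a α) (z t) l.length l := by
  obtain ⟨χ₀, hstable⟩ := hstable.isStableAll
  obtain ⟨χ, hχ, hχreg, hmem⟩ := exists_regular_forall_mem_HSet
    (fun p : Σ k, PhiPair (A := A) Δ k => p.2.toSet) χ₀
  let lt : HSet χ → HSet χ → Prop := WellOrderingRel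
  obtain ⟨x, hx⟩ := hstable χ hχ hχreg lt WellOrderingRel.isWellOrder
  let M : Type 1 := HModel χ lt
  have hM : Nonempty M := ⟨x⟩
  let q (α : Set.Iio κ.ord) (p : PairsOver Δ (paramsBelow P a α)) : M := ⟨_, hmem p.1⟩
  let X (α : Set.Iio κ.ord) : Set M := insert (x : M) (Set.range (q α))
  have hXmono : Monotone X := by
    rintro α β h _ (rfl | ⟨p, rfl⟩)
    · exact Or.inl rfl
    · exact Or.inr ⟨⟨p.1, fun y hy => paramsBelow_mono P a h (p.2 y hy)⟩, rfl⟩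
  let H (α : Set.Iio κ.ord) : (setLang.sum setLang.skolem₁).Substructure M :=
    closure (setLang.sum setLang.skolem₁) (X α)
  have hHmono : Monotone H := fun α β h => closure_mono (hXmono h)
  refine ⟨M, fun y => y.1, fun α => (H α : Set M), fun α β h => hHmono h, ?_, ?_, ?_⟩
  · intro α hne hlim t ht
    have : Nonempty (Set.Iio α) := hne.to_subtype
    have hdir : Directed (· ≤ ·) fun β : Set.Iio α => H β.1 :=
      Monotone.directed_le fun β γ h => hHmono h
    -- Each generator is present at an earlier stage, and a directed union of hulls is a hull.
    have hle : H α ≤ ⨆ β : Set.Iio α, H β.1 := by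
      refine closure_le.2 ?_
      rintro _ (rfl | ⟨p, rfl⟩)
      · obtain ⟨β, hβ⟩ := hne
        exact (mem_iSup_of_directed hdir).2 ⟨⟨β, hβ⟩, subset_closure (Or.inl rfl)⟩
      · obtain ⟨β, hβ, hp⟩ := exists_subset_paramsBelow hne hlim p.2
        exact (mem_iSup_of_directed hdir).2
          ⟨⟨β, hβ⟩, subset_closure (Or.inr ⟨⟨p.1, hp⟩, rfl⟩)⟩
    obtain ⟨β, hβ⟩ := (mem_iSup_of_directed hdir).1 (hle ht)
    exact ⟨β.1, β.2, hβ⟩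
  · intro α
    rw [mk_Iio_ord_eq_lift]
    have hκ' : ℵ₀ < Cardinal.lift.{1} κ := by simpa using hκ
    have hX : #(X α) < Cardinal.lift.{1} κ := by
      refine mk_insert_le.trans_lt (add_lt_of_lt hκ'.le ?_ (one_lt_aleph0.trans hκ'))
      have h1 := mk_range_le_lift (f := q α)
      rw [Cardinal.lift_id'.{0, 1}] at h1
      refine h1.trans_lt (Cardinal.lift_lt.2 ?_)
      exact mk_pairsOver_lt hΔ hκ (mk_paramsBelow_lt hκ hreg hP a α)
    have hfun : #(Σ i, (setLang.sum setLang.skolem₁).Functions i) ≤ ℵ₀ :=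
      card_functions_sum_skolem₁_le.trans (max_le le_rfl card_setLang_le)
    have hcl := lift_card_closure_le (L := setLang.sum setLang.skolem₁) (s := X α)
    simp only [Cardinal.lift_id'] at hcl
    refine hcl.trans_lt (max_lt hκ' (add_lt_of_lt hκ'.le hX (lt_of_le_of_lt ?_ hκ')))
    exact Cardinal.lift_le_aleph0.2 hfun
  · intro α l
    have hxN : x.1 ∈ elems (H α).elementarySkolem₁Reduct :=
      ⟨x, subset_closure (Or.inl rfl), rfl⟩
    -- The hull may be uncountable, so `DefinableOverAll` is needed here.
    obtain ⟨_, ⟨t, ht, rfl⟩, hdec⟩ := (hx _ hxN _ l.get).exists_decides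
      (B := paramsBelow P a α) fun p hp =>
        ⟨q α ⟨⟨_, p⟩, hp⟩, subset_closure (Or.inr ⟨_, rfl⟩), rfl⟩
    exact ⟨t, ht, hdec⟩

/-- Regressive functions on a club such that the types of increasing `n`-tuples on which the `n`-th
function is constant agree over everything below. -/
theorem exists_club_regressive (hΔ : Δ.Countable) (hstable : IsStable A Δ)
    (hneg : ClosedUnderNeg Δ) (hperm : ClosedUnderPerm Δ) {κ : Cardinal.{0}} (hκ : ℵ₀ < κ)
    (hreg : κ.IsRegular) {m : ℕ} {P : Set A} (hP : #P < κ) (a : Set.Iio κ.ord → Fin m → A) :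
    ∃ (E : Set (Set.Iio κ.ord)) (f : ℕ → Set.Iio κ.ord → Set.Iio κ.ord), IsClub E ∧
      (∀ n, ∀ α ∈ E, f n α < α) ∧
      (∀ n α β, f (n + 1) α = f (n + 1) β → f n α = f n β) ∧
      ∀ n (s t : Fin n → Set.Iio κ.ord), StrictMono s → StrictMono t →
        (∀ i j, f n (s i) = f n (t j)) → ∀ γ, (∀ i, γ ≤ s i) → (∀ i, γ ≤ t i) →
          SameType Δ (paramsBelow P a γ) (concat a s) (concat a t) := by
  have := isRegularCardinalOrder_Iio_ord hreg
  have hK : ℵ₀ < #(Set.Iio κ.ord) := by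
    rw [mk_Iio_ord_eq_lift]
    simpa using hκ
  obtain ⟨T, z, C, hmono, hcont, hcard, hdec⟩ := exists_chain hΔ hstable hκ hreg hP a
  obtain ⟨e, heC, hedown, he⟩ := exists_codes z (paramsBelow_mono P a)
    (fun δ α h i => Or.inr ⟨δ, h, i, rfl⟩) hneg hperm hdec
  obtain ⟨g, E, hE, hg, hgE⟩ := exists_regressive_coding hK hmono hcont hcard
  have hge : ∀ n α β, g (e n α) = g (e n β) → e n α = e n β := fun n α β h =>
    hg ⟨α, heC n α⟩ ⟨β, heC n β⟩ h
  refine ⟨E, fun n α => g (e n α), hE, fun n α hα => hgE α hα _ (heC n α), ?_, ?_⟩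
  · intro n α β h
    exact congrArg g (hedown n α β (hge _ _ _ h))
  · intro n s t hs ht hst γ hγs hγt
    exact he n s t hs ht (fun i j => hge _ _ _ (hst i j)) γ hγs hγt

end hulls

/-! ### From constant codes to indiscernibility -/

section indiscernibility

variable {L : FirstOrder.Language.{0, 0}} {A : Set (ℕ → ℕ)} [L.Structure A] [Nonempty A]
  {Δ : Set (Fml L)}

/-- A set on which `f n` is constant gives an end-extension indiscernible sequence. -/
theorem endExtIndiscernible_of_constant (hperm : ClosedUnderPerm Δ) {K : Type*} [LinearOrder K]
    {m : ℕ} {P : Set A} {a : K → Fin m → A} {f : ℕ → K → K}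
    (hf : ∀ n α β, f (n + 1) α = f (n + 1) β → f n α = f n β)
    (hsame : ∀ n (s t : Fin n → K), StrictMono s → StrictMono t →
      (∀ i j, f n (s i) = f n (t j)) → ∀ γ, (∀ i, γ ≤ s i) → (∀ i, γ ≤ t i) →
        SameType Δ (paramsBelow P a γ) (concat a s) (concat a t))
    {n : ℕ} {J : Set K} (hJ : ∀ α ∈ J, ∀ β ∈ J, f n α = f n β) {B : Set A}
    (hB : ∀ α ∈ J, B ⊆ paramsBelow P a α) :
    EndExtIndiscernible Δ n B fun t : J => a t := by
  have hdown : ∀ k ≤ n, ∀ α ∈ J, ∀ β ∈ J, f k α = f k β := by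
    intro k hk
    induction hk using Nat.decreasingInduction with
    | self => exact hJ
    | of_succ k _ ih => exact fun α hα β hβ => hf k α β (ih α hα β hβ)
  have key : ∀ k₀, ∀ k ≤ n, EndExtCondition Δ k₀ k B fun t : J => a t := by
    intro k₀ k hk r s t _ hs ht hrs hrt
    rcases k with - | k
    · rw [Subsingleton.elim s t]
      exact SameType.refl _ _ _
    -- All of `r` lies below `γ`, so its tuples count as parameters and are then moved in front.
    set γ : K := min (s 0).1 (t 0).1 with hγ
    have hγJ : γ ∈ J := by
      rcases min_choice (s 0).1 (t 0).1 with h | h <;> rw [hγ, h]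
      exacts [(s 0).2, (t 0).2]
    have hst := hsame (k + 1) (fun i => (s i).1) (fun i => (t i).1) (fun i j h => hs h)
      (fun i j h => ht h) (fun i j => hdown _ hk _ (s i).2 _ (t j).2) γ
      (fun i => (min_le_left _ _).trans (hs.monotone (Fin.zero_le i)))
      (fun i => (min_le_right _ _).trans (ht.monotone (Fin.zero_le i)))
    refine hst.append_left hperm (hB γ hγJ) fun x hx => ?_
    obtain ⟨i, j, rfl⟩ := mem_concat.1 hx
    exact Or.inr ⟨(r i).1, lt_min (hrs i 0) (hrt i 0), j, rfl⟩
  exact fun k₀ => ⟨key k₀ n le_rfl, fun _ k _ k' hk' => key k k' hk'⟩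

end indiscernibility

end EndExt

theorem claim7p4 {L : FirstOrder.Language.{0, 0}} [Countable L.Symbols]
    (A : Set (ℕ → ℕ)) [Nonempty A] [L.Structure A] (Δ : Set (Fml L))
    (hcand : IsCandidate A Δ) (hstable : IsStable A Δ) :
    -- the demand that `N` is countable can be omitted
    (IsStableAll A Δ ∧
      ∀ χ : Cardinal.{0}, χ.IsRegular →
        ∀ lt : HSet χ → HSet χ → Prop, IsWellOrder (HSet χ) lt → ∀ x : HSet χ,
          DefinableOverCountable A Δ χ lt x → DefinableOverAll A Δ χ lt x) ∧
    (ClosedUnderNeg Δ → ClosedUnderPerm Δ →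
      ∀ (m : ℕ) (κ : Cardinal.{0}), ℵ₀ < κ → κ.IsRegular →
      ∀ (a : Set.Iio κ.ord → Fin m → A) (S : Set (Set.Iio κ.ord)), IsStationary S →
      ∀ P : Set A, #P < κ →
        -- end-extension indiscernibility on a stationary subset
        (∃ S' ⊆ S, IsStationary S' ∧ EndExtIndiscernible Δ 1 P fun t : S' => a t) ∧
        -- the same for `n`-tuples
        (∀ n : ℕ, ∃ S' ⊆ S, IsStationary S' ∧ EndExtIndiscernible Δ n P fun t : S' => a t) ∧
        -- uniformly in `n`, by regressive functions on a club
        (∃ (E : Set (Set.Iio κ.ord)) (f : ℕ → Set.Iio κ.ord → Set.Iio κ.ord), IsClub E ∧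
          (∀ n, ∀ α ∈ S ∩ E, f n α < α) ∧
          (∀ n, ∀ α ∈ S ∩ E, ∀ β ∈ S ∩ E, f (n + 1) α = f (n + 1) β → f n α = f n β) ∧
          (∀ n, ∀ γ, EndExtIndiscernible Δ n P
            fun t : {α | α ∈ S ∩ E ∧ f n α = γ} => a t) ∧
          (∀ n, ∀ β γ, EndExtIndiscernible Δ n (P ∪ {y | ∃ δ < β, ∃ i, a δ i = y})
            fun t : {α | α ∈ S ∩ E ∧ β ≤ α ∧ f n α = γ} => a t))) := by
  refine ⟨⟨hstable.isStableAll, fun χ _ lt _ x hx => hx.definableOverAll⟩, ?_⟩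
  intro hneg hperm m κ hκ hreg a S hS P hP
  have := isRegularCardinalOrder_Iio_ord hreg
  have hK : ℵ₀ < #(Set.Iio κ.ord) := by
    rw [mk_Iio_ord_eq_lift]
    simpa using hκ
  obtain ⟨E, f, hE, hreg', hdown, hsame⟩ :=
    exists_club_regressive hcand.countable hstable hneg hperm hκ hreg hP a
  have hfiber : ∀ n γ, EndExtIndiscernible Δ n P
      fun t : {α | α ∈ S ∩ E ∧ f n α = γ} => a t := fun n γ =>
    endExtIndiscernible_of_constant hperm hdown hsame
      (fun α hα β hβ => hα.2.trans hβ.2.symm) fun α _ => Set.subset_union_left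
  have hstat : ∀ n : ℕ, ∃ S' ⊆ S, IsStationary S' ∧
      EndExtIndiscernible Δ n P fun t : S' => a t := by
    intro n
    obtain ⟨γ, hγ⟩ := (hS.inter_isClub hK hE).exists_fiber hK fun α hα => hreg' n α hα.2
    exact ⟨_, fun α hα => hα.1.1, hγ, hfiber n γ⟩
  refine ⟨hstat 1, hstat, E, f, hE, fun n α hα => hreg' n α hα.2,
    fun n α _ β _ h => hdown n α β h, hfiber, fun n β γ => ?_⟩
  -- All indices are at least `β`, so the enlarged parameter set is still below each of them.
  exact endExtIndiscernible_of_constant hperm hdown hsame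
    (fun α hα β hβ => hα.2.2.trans hβ.2.2.symm) fun α hα => paramsBelow_mono P a hα.2.1
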